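/- **Setting.** Instances are bit strings $x$, and $L\subseteq\{0,1\}^*$ is a language. All quantum registers are finite-dimensional. A *1-bit-challenge (receive-and-measure) $\Xi$-protocol* $\Pi=(P_1,P_2,V)$ works as follows on instance $x$. The prover, holding a witness state $|w\rangle$, prepares a state $|\varphi\rangle_{AB}$ using an isometry $P_1$, and sends the register $A$. The verifier sends a uniformly random bit $c$ and measures $A$ with a POVM $\{E^x_{c,a}\}_a$ chosen by $c$, getting an outcome $a$. The prover measures its register $B$ according to $P_2$ and $c$, and sends the outcome, a classical response $r\in\{0,1\}^{\ell(x)}$. The verifier accepts iff a predicate $V(x,a,c,r)$ holds. The protocol $\Pi$ is *$\varepsilon$-sound* for $L$ if for every $x\notin L$ and every (unbounded) quantum prover, i.e. every state $\rho_{AB}$ with a register $B$ of arbitrary finite dimension and all POVMs $\{M_{c,r}\}_r$ on $B$ for $c\in\{0,1\}$, $$\frac12\sum_{c}\ \sum_{a,r\,:\,V(x,a,c,r)=1}\operatorname{tr}\big(\rho\,(E^x_{c,a}\otimes M_{c,r})\big)\le\varepsilon .$$ **The compiler.** Let $k,n\ge 0$ be integers and, for each $x$, let $\mathcal H_x$ be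 a universal$_2$ family of hash functions from bit strings of length at most $n$ to $\{0,1\}^{\ell(x)}$. For $s,\theta\in\{0,1\}^n$ write $|s\rangle_\theta=\bigotimes_j H^{\theta_j}|s_j\rangle$ with $H$ the Hadamard transform, and let $s^{c}$ be the substring of $s$ at the positions $j$ with $\theta_j=c$. The one-message protocol $\mathsf{NIP}[\Pi]$ on $x$ is the following; there is no setup. * *Prover.* Independently for each $i\in[k]$: prepare a first message $\varphi_i$ (in register $A_i$) with $P_1$ and compute with $P_2$ the responses $r_i^0,r_i^1$ to both challenges; choose uniformly random $s_i,\theta_i\in\{0,1\}^n$ and $h_i^0,h_i^1\in\mathcal H_x$; put $|s_i\rangle_{\theta_i}$ in register $X_i$ and let $m_i^c=r_i^c\oplus h_i^c(s_i^{c})$ for $c\in\{0,1\}$. Send the quantum registers $A_1X_1\cdots A_kX_k$, followed by the classical data $(\theta_i,h_i^0,h_i^1,m_i^0,m_i^1)_{i\in[k]}$. * *Verifier.* Choose uniformly random bits $c_1,\dots,c_k$. Before receiving the classical data, measure for each $i$ the register $A_i$ with $\{E^x_{c_i,a}\}_a$, getting $a_i$, and all $n$ qubits of $X_i$ in the computational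 basis if $c_i=0$, in the Hadamard basis if $c_i=1$, getting $s_i'$. Let $s_i'^{\,c_i}$ be the substring of $s_i'$ at the positions $j$ with $(\theta_i)_j=c_i$, and put $r_i=m_i^{c_i}\oplus h_i^{c_i}(s_i'^{\,c_i})$. Accept iff $V(x,a_i,c_i,r_i)=1$ for all $i\in[k]$. **Theorem.** Let $\Pi$ be a 1-bit-challenge receive-and-measure $\Xi$-protocol that is $\tfrac12$-sound for $L$ against quantum provers. Then $\mathsf{NIP}[\Pi]$ is sound with soundness error $2^{-k}$: for every $x\notin L$ and every malicious prover, unbounded in computation and memory, i.e. every joint state of the quantum registers $A_1X_1\cdots A_kX_k$ and the classical data (possibly entangled across the copies and correlated with the classical data), the verifier accepts with probability at most $2^{-k}$. -/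

import Mathlib

open scoped BigOperators Matrix ComplexOrder Kronecker

noncomputable section

/-! ### Finite-dimensional quantum mechanics -/

/-- Bit strings of length `m`; they also label the computational basis of `m` qubits. -/
abbrev Bits (m : ℕ) : Type := Fin m → Bool

/-- A measurement (POVM) with outcomes in `O` on a register with computational basis `Q`. -/
structure POVM (Q O : Type) [Fintype Q] [DecidableEq Q] [Fintype O] where
  elem : O → Matrix Q Q ℂ
  psd : ∀ o, (elem o).PosSemidef
  sum_elem : ∑ o, elem o = 1

/-- A (mixed) state of a register with computational basis `Q`. -/
structure DensityOp (Q : Type) [Fintype Q] where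
  op : Matrix Q Q ℂ
  psd : op.PosSemidef
  trace_op : op.trace = 1

/-- A joint state of a quantum register `Q` and a classical register `T`:
the state is `∑ t, ρ t ⊗ |t⟩⟨t|`, so that `tr (ρ t)` is the probability of the classical value `t`
and `ρ t` is the corresponding unnormalised state of `Q`. -/
structure CQState (Q T : Type) [Fintype Q] [Fintype T] where
  op : T → Matrix Q Q ℂ
  psd : ∀ t, (op t).PosSemidef
  trace_op : ∑ t, (op t).trace = 1

/-- The tensor product `M 0 ⊗ ⋯ ⊗ M (k-1)` of operators on `k` registers. -/
def tensorAll {k : ℕ} {Q R : Type} (M : Fin k → Matrix Q R ℂ) :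
    Matrix (Fin k → Q) (Fin k → R) ℂ :=
  Matrix.of fun u v => ∏ i, M i (u i) (v i)

/-- The rank-one operator `|v⟩⟨v|`. -/
def ketbra {Q : Type} (v : Q → ℂ) : Matrix Q Q ℂ := Matrix.vecMulVec v (star v)

theorem ketbra_psd {Q : Type} [Fintype Q] (v : Q → ℂ) : (ketbra v).PosSemidef :=
  Matrix.posSemidef_vecMulVec_self_star v

theorem tensorAll_mul {k : ℕ} {Q R S : Type} [Fintype R]
    (M : Fin k → Matrix Q R ℂ) (N : Fin k → Matrix R S ℂ) :
    tensorAll M * tensorAll N = tensorAll fun i => M i * N i := by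
  ext u v
  simp only [tensorAll, Matrix.mul_apply, Matrix.of_apply, ← Finset.prod_mul_distrib]
  rw [Finset.prod_univ_sum, Fintype.piFinset_univ]

open scoped MatrixOrder in
theorem tensorAll_psd {k : ℕ} {Q : Type} [Fintype Q] {M : Fin k → Matrix Q Q ℂ}
    (h : ∀ i, (M i).PosSemidef) : (tensorAll M).PosSemidef := by
  classical
  have hex : ∀ i, ∃ B : Matrix Q Q ℂ, M i = Bᴴ * B := fun i =>
    CStarAlgebra.nonneg_iff_eq_star_mul_self.1 (Matrix.nonneg_iff_posSemidef.2 (h i))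
  choose B hB using hex
  have h1 : tensorAll M = (tensorAll B)ᴴ * tensorAll B := by
    have h2 : (tensorAll B)ᴴ = tensorAll fun i => (B i)ᴴ := by
      ext u v
      simp [tensorAll, Matrix.conjTranspose_apply]
    rw [h2, tensorAll_mul]
    congr 1
    funext i
    exact hB i
  rw [h1]
  exact Matrix.posSemidef_conjTranspose_mul_self _

theorem tensorAll_trace {k : ℕ} {Q : Type} [Fintype Q] (M : Fin k → Matrix Q Q ℂ) :
    (tensorAll M).trace = ∏ i, (M i).trace := by
  simp only [tensorAll, Matrix.trace, Matrix.diag, Matrix.of_apply]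
  rw [Finset.prod_univ_sum, Fintype.piFinset_univ]

theorem tensorAll_one {k : ℕ} {Q : Type} [DecidableEq Q] :
    tensorAll (fun _ : Fin k => (1 : Matrix Q Q ℂ)) = 1 := by
  ext u v
  simp only [tensorAll, Matrix.of_apply, Matrix.one_apply]
  by_cases h : u = v
  · simp [h]
  · obtain ⟨i, hi⟩ := Function.ne_iff.1 h
    rw [if_neg h]
    exact Finset.prod_eq_zero (Finset.mem_univ i) (if_neg hi)

theorem tensorAll_sum {k : ℕ} {Q O : Type} [Fintype O] (E : Fin k → O → Matrix Q Q ℂ) :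
    ∑ o : Fin k → O, tensorAll (fun i => E i (o i)) = tensorAll fun i => ∑ a, E i a := by
  ext u v
  simp only [tensorAll, Matrix.sum_apply, Matrix.of_apply]
  rw [Finset.prod_univ_sum, Fintype.piFinset_univ]

namespace POVM

variable {Q Q' O O' : Type} [Fintype Q] [DecidableEq Q] [Fintype Q'] [DecidableEq Q']
  [Fintype O] [Fintype O']

/-- Measuring two registers separately. -/
def prod (E : POVM Q O) (F : POVM Q' O') : POVM (Q × Q') (O × O') where
  elem o := E.elem o.1 ⊗ₖ F.elem o.2
  psd o := (E.psd o.1).kronecker (F.psd o.2)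
  sum_elem := by
    have h : ∑ o : O × O', E.elem o.1 ⊗ₖ F.elem o.2 = (∑ a, E.elem a) ⊗ₖ (∑ b, F.elem b) := by
      ext u v
      simp only [Matrix.sum_apply, Matrix.kroneckerMap_apply, Fintype.sum_prod_type,
        Finset.sum_mul_sum]
    rw [h, E.sum_elem, F.sum_elem, Matrix.one_kronecker_one]

/-- Measuring `k` registers separately. -/
def pi {k : ℕ} (E : Fin k → POVM Q O) : POVM (Fin k → Q) (Fin k → O) where
  elem o := tensorAll fun i => (E i).elem (o i)
  psd o := tensorAll_psd fun i => (E i).psd (o i)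
  sum_elem := by
    rw [tensorAll_sum fun i => (E i).elem]
    simp only [POVM.sum_elem]
    exact tensorAll_one

end POVM

/-! ### BB84 states -/

/-- The amplitude `⟨y| H^θ |x⟩` for single bits, where `H` is the Hadamard transform. -/
def hadamardAmp (θ y x : Bool) : ℂ :=
  if θ then (if x && y then -1 else 1) / (Real.sqrt 2 : ℂ) else if y = x then 1 else 0

/-- The BB84 state `|x⟩_θ = ⨂ⱼ H^{θⱼ} |xⱼ⟩`. The bit `false` stands for the computational basis
`+`, the bit `true` for the Hadamard basis `×`. -/
def bb84 {n : ℕ} (θ x : Bits n) : Bits n → ℂ := fun y => ∏ j, hadamardAmp (θ j) (y j) (x j)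

theorem sqrt_two_mul_self_complex : (Real.sqrt 2 : ℂ) * (Real.sqrt 2 : ℂ) = 2 := by
  rw [← Complex.ofReal_mul, Real.mul_self_sqrt (by norm_num)]
  norm_num

theorem hadamardAmp_complete (θ y z : Bool) :
    ∑ x, hadamardAmp θ y x * star (hadamardAmp θ z x) = if y = z then 1 else 0 := by
  have h2 := sqrt_two_mul_self_complex
  have h0 : (Real.sqrt 2 : ℂ) ≠ 0 := by
    intro h
    rw [h] at h2
    norm_num at h2
  cases θ <;> cases y <;> cases z <;> simp [hadamardAmp] <;> field_simp <;>
    norm_num [pow_two, h2]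

theorem hadamardAmp_unit (θ x : Bool) :
    ∑ y, hadamardAmp θ y x * star (hadamardAmp θ y x) = 1 := by
  have h2 := sqrt_two_mul_self_complex
  have h0 : (Real.sqrt 2 : ℂ) ≠ 0 := by
    intro h
    rw [h] at h2
    norm_num at h2
  cases θ <;> cases x <;> simp [hadamardAmp] <;> field_simp <;>
    norm_num [pow_two, h2]

theorem bb84_trace {n : ℕ} (θ x : Bits n) : (ketbra (bb84 θ x)).trace = 1 := by
  simp only [ketbra, bb84, Matrix.trace, Matrix.diag, Matrix.vecMulVec_apply, Pi.star_apply,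
    star_prod, ← Finset.prod_mul_distrib]
  rw [← Fintype.piFinset_univ,
    ← Finset.prod_univ_sum (fun _ => Finset.univ)
      fun j y => hadamardAmp (θ j) y (x j) * star (hadamardAmp (θ j) y (x j))]
  simp only [hadamardAmp_unit, Finset.prod_const_one]

/-- Measuring qubit number `j` in the basis `+` or `×` according to `θ j`, for all `j`. -/
def bb84Meas {n : ℕ} (θ : Bits n) : POVM (Bits n) (Bits n) where
  elem x := ketbra (bb84 θ x)
  psd x := ketbra_psd _
  sum_elem := by
    ext u v
    simp only [ketbra, bb84, Matrix.sum_apply, Matrix.vecMulVec_apply, Pi.star_apply,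
      star_prod, ← Finset.prod_mul_distrib]
    rw [← Fintype.piFinset_univ,
      ← Finset.prod_univ_sum (fun _ => Finset.univ)
        fun j x => hadamardAmp (θ j) (u j) x * star (hadamardAmp (θ j) (v j) x)]
    simp only [hadamardAmp_complete, Matrix.one_apply]
    by_cases h : u = v
    · simp [h]
    · obtain ⟨i, hi⟩ := Function.ne_iff.1 h
      rw [if_neg h]
      exact Finset.prod_eq_zero (Finset.mem_univ i) (if_neg hi)

/-! ### Three-message protocols with a one-bit challenge -/

/-- A 1-bit-challenge `Ξ`-protocol whose verifier is receive-and-measure; instances are bit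
strings `x`.

* The prover, on a witness state `|w⟩`, prepares `|φ⟩_{AB} = P₁ |w⟩` with an isometry `P₁` and
  sends register `A`.
* The verifier sends a uniformly random challenge `c`, and measures `A` with a measurement chosen
  by `c`, obtaining an outcome `a`.
* The prover computes its classical response `r` by measuring its register `B`; the measurement
  is given by the measurement operators `P₂ c r` (the state changes to `P₂ c r |·⟩`).
* The verifier accepts iff `pred a c r` is true. -/
structure XiProtocol where
  witQubits : List Bool → ℕ
  msgQubits : List Bool → ℕ
  privQubits : List Bool → ℕ
  respLen : List Bool → ℕ
  outLen : List Bool → ℕ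
  prover₁ : ∀ x, Matrix (Bits (msgQubits x) × Bits (privQubits x)) (Bits (witQubits x)) ℂ
  prover₁_isometry : ∀ x, (prover₁ x)ᴴ * prover₁ x = 1
  prover₂ : ∀ x, Bool → Bits (respLen x) →
    Matrix (Bits (privQubits x)) (Bits (privQubits x)) ℂ
  prover₂_complete : ∀ x c, ∑ r, (prover₂ x c r)ᴴ * prover₂ x c r = 1
  meas : ∀ x, Bool → POVM (Bits (msgQubits x)) (Bits (outLen x))
  pred : ∀ x, Bits (outLen x) → Bool → Bits (respLen x) → Bool

/-- A (malicious, computationally and memory unbounded) prover strategy in the interactive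
protocol: a joint state of the first message `A` and of a private register `B` of arbitrary finite
dimension, and for each challenge a measurement of `B` giving the response. -/
structure InteractiveProver (A R : Type) [Fintype A] [DecidableEq A] [Fintype R] where
  B : Type
  [fintypeB : Fintype B]
  [decEqB : DecidableEq B]
  state : DensityOp (A × B)
  respond : Bool → POVM B R

attribute [instance] InteractiveProver.fintypeB InteractiveProver.decEqB

namespace XiProtocol

/-- The probability that the verifier of `P` accepts on instance `x`, interacting with `S`. -/
def acceptProb (P : XiProtocol) (x : List Bool)
    (S : InteractiveProver (Bits (P.msgQubits x)) (Bits (P.respLen x))) : ℝ :=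
  (1 / 2) * ∑ c : Bool, ∑ a, ∑ r,
    if P.pred x a c r then
      (S.state.op * ((P.meas x c).elem a ⊗ₖ (S.respond c).elem r)).trace.re
    else 0

/-- `P` is `ε`-sound for the language `L`, against all quantum provers. -/
def IsSound (P : XiProtocol) (L : Language Bool) (ε : ℝ) : Prop :=
  ∀ x, x ∉ L → ∀ S, P.acceptProb x S ≤ ε

end XiProtocol

/-! ### One-message protocols -/

/-- A one-message proof (for one fixed instance): without any setup, the prover sends a quantum
register `Q` and a classical message in `T`. The verifier draws `coin` uniformly at random,
measures `Q` with a measurement depending on `coin` only (thus before it gets the classical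
message, so it needs no quantum memory), and finally decides from its coins, its measurement
outcome, and the classical message. -/
structure OneMessageProof (W Q T C O : Type) [Fintype Q] [DecidableEq Q] [Fintype T] [Fintype C]
    [Fintype O] where
  honest : W → CQState Q T
  meas : C → POVM Q O
  decision : C → O → T → Prop

namespace OneMessageProof

open scoped Classical in
/-- The probability that the verifier accepts the message `ρ`. -/
def acceptProb {W Q T C O : Type} [Fintype Q] [DecidableEq Q] [Fintype T] [Fintype C] [Fintype O]
    (P : OneMessageProof W Q T C O) (ρ : CQState Q T) : ℝ :=
  (Fintype.card C : ℝ)⁻¹ * ∑ c, ∑ t, ∑ o,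
    if P.decision c o t then (ρ.op t * (P.meas c).elem o).trace.re else 0

/-- A family of one-message proofs, indexed by the instances, is `ε`-sound for `L`: on a
no-instance, whatever prover (without any bound on its time or memory) prepared the message,
i.e. for every joint state of the quantum and classical parts of the message, the verifier accepts
with probability at most `ε`. -/
def IsSound {W Q T C O : List Bool → Type} [∀ x, Fintype (Q x)] [∀ x, DecidableEq (Q x)]
    [∀ x, Fintype (T x)] [∀ x, Fintype (C x)] [∀ x, Fintype (O x)]
    (P : ∀ x, OneMessageProof (W x) (Q x) (T x) (C x) (O x)) (L : Language Bool) (ε : ℝ) : Prop :=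
  ∀ x, x ∉ L → ∀ ρ : CQState (Q x) (T x), (P x).acceptProb ρ ≤ ε

end OneMessageProof

/-! ### The compiler -/

/-- A universal₂ family of hash functions from strings of length at most `n` to `ℓ` bits. -/
structure UniversalHash (n ℓ : ℕ) where
  Key : Type
  [fintypeKey : Fintype Key]
  [nonemptyKey : Nonempty Key]
  eval : Key → List Bool → Bits ℓ
  universal : ∀ u v : List Bool, u ≠ v → u.length = v.length → u.length ≤ n →
    (Finset.univ.filter fun h => eval h u = eval h v).card * 2 ^ ℓ ≤ Fintype.card Key

attribute [instance] UniversalHash.fintypeKey UniversalHash.nonemptyKey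

/-- The substring of `x` at the positions `j` with `θ j = c`. -/
def substring {n : ℕ} (θ : Bits n) (c : Bool) (x : Bits n) : List Bool :=
  ((List.finRange n).filter fun j => θ j == c).map x

/-- Bitwise exclusive or. -/
def xorBits {ℓ : ℕ} (a b : Bits ℓ) : Bits ℓ := fun j => xor (a j) (b j)

/-- The classical part `(θ, (h⁰, h¹), (m⁰, m¹))` of an oblivious transfer. -/
abbrev OTMsg {n ℓ : ℕ} (H : UniversalHash n ℓ) : Type :=
  Bits n × (Bool → H.Key) × (Bool → Bits ℓ)

/-- The masked inputs `m^c = r^c ⊕ h^c(x^c)` of the oblivious transfer sender. -/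
def otMask {n ℓ : ℕ} (H : UniversalHash n ℓ) (θ : Bits n) (h : Bool → H.Key) (x : Bits n)
    (r : Bool → Bits ℓ) : Bool → Bits ℓ :=
  fun c => xorBits (r c) (H.eval (h c) (substring θ c x))

/-- What a receiver with choice bit `c` and measurement result `x'` outputs:
`m^c ⊕ h^c(x'^c)`. -/
def otOutput {n ℓ : ℕ} (H : UniversalHash n ℓ) (t : OTMsg H) (c : Bool) (x' : Bits n) : Bits ℓ :=
  xorBits (t.2.2 c) (H.eval (t.2.1 c) (substring t.1 c x'))

namespace XiProtocol

/-- A pure witness state. -/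
structure Witness (P : XiProtocol) (x : List Bool) where
  vec : Bits (P.witQubits x) → ℂ
  unit : star vec ⬝ᵥ vec = 1

/-- The joint unnormalised vector on `AB` after the honest prover has prepared `P₁ |w⟩` and has
computed from `B` the response `r 0` to challenge `0` and then the response `r 1` to
challenge `1`. -/
def bothResponses (P : XiProtocol) (x : List Bool) (w : P.Witness x)
    (r : Bool → Bits (P.respLen x)) : Bits (P.msgQubits x) × Bits (P.privQubits x) → ℂ :=
  (((1 : Matrix (Bits (P.msgQubits x)) (Bits (P.msgQubits x)) ℂ) ⊗ₖ
    (P.prover₂ x true (r true) * P.prover₂ x false (r false))) * P.prover₁ x) *ᵥ w.vec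

/-- The corresponding unnormalised state of `A` (the partial trace over `B`). -/
def firstMessage (P : XiProtocol) (x : List Bool) (w : P.Witness x)
    (r : Bool → Bits (P.respLen x)) :
    Matrix (Bits (P.msgQubits x)) (Bits (P.msgQubits x)) ℂ :=
  ∑ b, ketbra fun a => P.bothResponses x w r (a, b)

/-- The honest prover's message in one copy, as an unnormalised state of the quantum registers
`A` and `X` for each value of the classical message `(θ, h, m)`: `θ`, the string `s` encoded in
`X`, and the two hash functions are uniformly random. -/
def copyState (P : XiProtocol) {n : ℕ} (x : List Bool) (H : UniversalHash n (P.respLen x))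
    (w : P.Witness x) (t : OTMsg H) :
    Matrix (Bits (P.msgQubits x) × Bits n) (Bits (P.msgQubits x) × Bits n) ℂ :=
  (Fintype.card (Bits n × (Bool → H.Key) × Bits n) : ℂ)⁻¹ •
    ∑ s : Bits n, ∑ r : Bool → Bits (P.respLen x),
      if t.2.2 = otMask H t.1 t.2.1 s r then P.firstMessage x w r ⊗ₖ ketbra (bb84 t.1 s) else 0

theorem firstMessage_psd (P : XiProtocol) (x : List Bool) (w : P.Witness x)
    (r : Bool → Bits (P.respLen x)) : (P.firstMessage x w r).PosSemidef :=
  Matrix.posSemidef_sum _ fun _ _ => ketbra_psd _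

theorem copyState_psd (P : XiProtocol) {n : ℕ} (x : List Bool)
    (H : UniversalHash n (P.respLen x)) (w : P.Witness x) (t : OTMsg H) :
    (P.copyState x H w t).PosSemidef := by
  unfold copyState
  refine Matrix.PosSemidef.smul ?_ ?_
  · refine Matrix.posSemidef_sum _ fun s _ => Matrix.posSemidef_sum _ fun r _ => ?_
    split_ifs
    · exact (P.firstMessage_psd x w r).kronecker (ketbra_psd _)
    · exact Matrix.PosSemidef.zero
  · have h : ((Fintype.card (Bits n × (Bool → H.Key) × Bits n) : ℂ))⁻¹ =
        (((Fintype.card (Bits n × (Bool → H.Key) × Bits n) : ℝ)⁻¹ : ℝ) : ℂ) := by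
      push_cast
      rfl
    rw [h]
    exact Complex.zero_le_real.2 (by positivity)

theorem sum_measured {W A B R : Type} [Fintype W] [DecidableEq W] [Fintype A] [DecidableEq A]
    [Fintype B] [DecidableEq B] [Fintype R] (U : Matrix (A × B) W ℂ) (hU : Uᴴ * U = 1)
    (K : R → Matrix B B ℂ) (hK : ∑ r, (K r)ᴴ * K r = 1) (w : W → ℂ) (hw : star w ⬝ᵥ w = 1) :
    ∑ r, star ((Matrix.kronecker (1 : Matrix A A ℂ) (K r) * U) *ᵥ w) ⬝ᵥ
      ((Matrix.kronecker (1 : Matrix A A ℂ) (K r) * U) *ᵥ w) = 1 := by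
  have h2 : ∀ r, star ((Matrix.kronecker (1 : Matrix A A ℂ) (K r) * U) *ᵥ w) ⬝ᵥ
      ((Matrix.kronecker (1 : Matrix A A ℂ) (K r) * U) *ᵥ w) =
      star w ⬝ᵥ ((Uᴴ * (Matrix.kronecker (1 : Matrix A A ℂ) ((K r)ᴴ * K r) * U)) *ᵥ w) := by
    intro r
    have h3 : Matrix.kronecker (1 : Matrix A A ℂ) ((K r)ᴴ * K r) =
        (Matrix.kronecker (1 : Matrix A A ℂ) (K r))ᴴ * Matrix.kronecker (1 : Matrix A A ℂ) (K r) := by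
      simp only [Matrix.kronecker]
      rw [Matrix.conjTranspose_kronecker,
        Matrix.conjTranspose_one, ← Matrix.mul_kronecker_mul, Matrix.one_mul]
    rw [h3, Matrix.star_mulVec, ← Matrix.dotProduct_mulVec, Matrix.mulVec_mulVec,
      Matrix.conjTranspose_mul]
    simp only [Matrix.mul_assoc]
  have h4 : ∑ r, Matrix.kronecker (1 : Matrix A A ℂ) ((K r)ᴴ * K r) = 1 := by
    have h5 : ∑ r, Matrix.kronecker (1 : Matrix A A ℂ) ((K r)ᴴ * K r) =
        Matrix.kronecker (1 : Matrix A A ℂ) (∑ r, (K r)ᴴ * K r) := by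
      ext u v
      simp only [Matrix.sum_apply, Matrix.kronecker, Matrix.kroneckerMap_apply, Finset.mul_sum]
    rw [h5, hK]
    exact Matrix.one_kronecker_one
  simp only [h2]
  rw [← dotProduct_sum, ← Matrix.sum_mulVec, ← Matrix.mul_sum, ← Matrix.sum_mul, h4,
    Matrix.one_mul, hU, Matrix.one_mulVec, hw]

theorem firstMessage_trace (P : XiProtocol) (x : List Bool) (w : P.Witness x) :
    ∑ r, (P.firstMessage x w r).trace = 1 := by
  let K : (Bool → Bits (P.respLen x)) → Matrix _ _ ℂ := fun r =>
    P.prover₂ x true (r true) * P.prover₂ x false (r false)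
  have hK : ∑ r, (K r)ᴴ * K r = 1 := by
    rw [← (Equiv.boolArrowEquivProd _).symm.sum_comp, Fintype.sum_prod_type]
    have h : ∀ a b, (K ((Equiv.boolArrowEquivProd _).symm (a, b)))ᴴ *
        K ((Equiv.boolArrowEquivProd _).symm (a, b)) =
        (P.prover₂ x false a)ᴴ * (((P.prover₂ x true b)ᴴ * P.prover₂ x true b) *
          P.prover₂ x false a) := by
      intro a b
      simp only [K, Equiv.boolArrowEquivProd, Equiv.coe_fn_symm_mk, Matrix.conjTranspose_mul,
        Matrix.mul_assoc, if_true, Bool.false_eq_true, if_false]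
    simp only [h, ← Finset.mul_sum, ← Finset.sum_mul, P.prover₂_complete, Matrix.one_mul]
  have h1 : ∀ r, (P.firstMessage x w r).trace =
      star (P.bothResponses x w r) ⬝ᵥ P.bothResponses x w r := by
    intro r
    simp only [firstMessage, ketbra, Matrix.trace_sum, Matrix.trace_vecMulVec, dotProduct,
      Pi.star_apply, Fintype.sum_prod_type]
    rw [Finset.sum_comm]
    exact Finset.sum_congr rfl fun a _ => Finset.sum_congr rfl fun b _ => mul_comm _ _
  simp only [h1]
  exact sum_measured (P.prover₁ x) (P.prover₁_isometry x) K hK w.vec w.unit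

theorem copyState_trace (P : XiProtocol) {n : ℕ} (x : List Bool)
    (H : UniversalHash n (P.respLen x)) (w : P.Witness x) :
    ∑ t, (P.copyState x H w t).trace = 1 := by
  have h : ∀ t : OTMsg H, (P.copyState x H w t).trace =
      (Fintype.card (Bits n × (Bool → H.Key) × Bits n) : ℂ)⁻¹ *
        ∑ s : Bits n, ∑ r : Bool → Bits (P.respLen x),
          if t.2.2 = otMask H t.1 t.2.1 s r then (P.firstMessage x w r).trace else 0 := by
    intro t
    simp only [copyState, Matrix.trace_smul, Matrix.trace_sum, smul_eq_mul]
    congr 1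
    refine Finset.sum_congr rfl fun s _ => Finset.sum_congr rfl fun r _ => ?_
    split_ifs
    · rw [Matrix.trace_kronecker, bb84_trace, mul_one]
    · exact Matrix.trace_zero _ _
  simp only [h, ← Finset.mul_sum]
  have h2 : ∑ t : OTMsg H, ∑ s : Bits n, ∑ r : Bool → Bits (P.respLen x),
      (if t.2.2 = otMask H t.1 t.2.1 s r then (P.firstMessage x w r).trace else 0) =
      (Fintype.card (Bits n × (Bool → H.Key) × Bits n) : ℂ) := by
    simp only [Fintype.sum_prod_type]
    have h3 : ∀ (θ : Bits n) (g : Bool → H.Key), ∑ m : Bool → Bits (P.respLen x), ∑ s : Bits n,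
        ∑ r : Bool → Bits (P.respLen x),
        (if m = otMask H θ g s r then (P.firstMessage x w r).trace else 0) =
        (Fintype.card (Bits n) : ℂ) := by
      intro θ g
      rw [Finset.sum_comm]
      have h4 : ∀ s : Bits n, ∑ m : Bool → Bits (P.respLen x), ∑ r : Bool → Bits (P.respLen x),
          (if m = otMask H θ g s r then (P.firstMessage x w r).trace else 0) = 1 := by
        intro s
        rw [Finset.sum_comm]
        simp only [Finset.sum_ite_eq', Finset.mem_univ, if_true]
        exact P.firstMessage_trace x w
      simp [h4]
    simp only [h3, Finset.sum_const, Finset.card_univ, nsmul_eq_mul, Fintype.card_prod,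
      Nat.cast_mul]
  rw [h2]
  exact inv_mul_cancel₀ (Nat.cast_ne_zero.2 Fintype.card_ne_zero)

/-- The compiled protocol on instance `x`, with `k` copies of `P` and `n`-qubit oblivious
transfers. In copy `i` the prover sends the quantum registers `Aᵢ` (the first message of `P`) and
`Xᵢ` (a BB84 state), and the classical message `(θᵢ, hᵢ, mᵢ)`. The verifier's coins are the
selection bits `cᵢ`; it measures `Aᵢ` as the verifier of `P` does on challenge `cᵢ` and all of `Xᵢ`
in basis `cᵢ`, recovers the response to `cᵢ`, and accepts iff all copies accept. -/
def NIP (P : XiProtocol) {n : ℕ} (H : ∀ x, UniversalHash n (P.respLen x)) (k : ℕ)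
    (x : List Bool) :
    OneMessageProof (P.Witness x) (Fin k → Bits (P.msgQubits x) × Bits n) (Fin k → OTMsg (H x))
      (Bits k) (Fin k → Bits (P.outLen x) × Bits n) where
  honest w :=
    { op := fun t => tensorAll fun i => P.copyState x (H x) w (t i)
      psd := fun t => tensorAll_psd fun i => P.copyState_psd x (H x) w (t i)
      trace_op := by
        simp only [tensorAll_trace]
        rw [← Fintype.piFinset_univ,
          ← Finset.prod_univ_sum (fun _ => Finset.univ)
            fun _ t => (P.copyState x (H x) w t).trace]
        simp only [copyState_trace, Finset.prod_const_one] }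
  meas c := POVM.pi fun i => (P.meas x (c i)).prod (bb84Meas fun _ => c i)
  decision c o t := ∀ i, P.pred x (o i).1 (c i) (otOutput (H x) (t i) (c i) (o i).2) = true

end XiProtocol

end

/-! Fix the classical message `t`. In copy `i` let `S i` be the sum over both challenges of the
verifier's acceptance operators. An interactive prover for Π may hand over `A` and keep `X`, then
measure `X` in the basis named by the challenge and unmask the result using `t`. It reproduces the
compiled verifier's acceptance, so ½-soundness says that `½ tr(σ S i) ≤ ½` for every state σ, that
is, `S i ≤ 1` (`sum_copyAccept_le_one`).

The joint acceptance operator for a challenge string is a tensor product over the copies. Summing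
over all strings therefore gives `⨂ S i`, and the acceptance probability is `2⁻ᵏ ∑ t, tr (ρ t ⨂ S
i)` (`NIP_acceptProb`).

Since `0 ≤ S i ≤ 1` implies `⨂ S i ≤ 1`, the sum over `t` is at most the total trace 1. This is an
operator inequality, so entanglement across copies and correlation with `t` do not matter. -/

open scoped MatrixOrder in
theorem Matrix.PosSemidef.trace_mul_re_nonneg {Q : Type} [Fintype Q] {ρ M : Matrix Q Q ℂ}
    (hρ : ρ.PosSemidef) (hM : M.PosSemidef) : 0 ≤ (ρ * M).trace.re := by
  classical
  obtain ⟨B, hB⟩ := CStarAlgebra.nonneg_iff_eq_star_mul_self.1 (Matrix.nonneg_iff_posSemidef.2 hρ)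
  -- With `ρ = Bᴴ B`, cyclicity of the trace exposes a congruence of `M`, which is again positive
  -- semidefinite.
  have h : (ρ * M).trace = (B * M * Bᴴ).trace := by
    rw [hB, Matrix.star_eq_conjTranspose, Matrix.mul_assoc, Matrix.trace_mul_comm]
  rw [h]
  exact (Complex.le_def.1 (hM.mul_mul_conjTranspose_same B).trace_nonneg).1

theorem ketbra_mul_trace {Q : Type} [Fintype Q] (v : Q → ℂ) (M : Matrix Q Q ℂ) :
    (ketbra v * M).trace = star v ⬝ᵥ (M *ᵥ v) := by
  rw [Matrix.trace_mul_comm, ketbra, Matrix.mul_vecMulVec, Matrix.trace_vecMulVec, dotProduct_comm]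

/-- The pure state proportional to a nonzero vector. -/
noncomputable def DensityOp.ofVec {Q : Type} [Fintype Q] (v : Q → ℂ) (hv : v ≠ 0) : DensityOp Q where
  op := (star v ⬝ᵥ v)⁻¹ • ketbra v
  psd := (ketbra_psd v).smul (inv_nonneg.2 (dotProduct_star_self_nonneg v))
  trace_op := by
    rw [Matrix.trace_smul, ketbra, Matrix.trace_vecMulVec, smul_eq_mul, dotProduct_comm v]
    exact inv_mul_cancel₀ (dotProduct_star_self_eq_zero.not.2 hv)

/-- An operator with expectation at most `1` in every state is at most the identity. -/
theorem one_sub_posSemidef_of_trace_le {Q : Type} [Fintype Q] [DecidableEq Q] {S : Matrix Q Q ℂ}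
    (hS : S.PosSemidef) (h : ∀ σ : DensityOp Q, (σ.op * S).trace.re ≤ 1) :
    (1 - S).PosSemidef := by
  have hH : (1 - S).IsHermitian := Matrix.isHermitian_one.sub hS.isHermitian
  refine Matrix.PosSemidef.of_dotProduct_mulVec_nonneg hH fun v => ?_
  by_cases hv : v = 0
  · simp [hv]
  -- Testing on the normalised `v` suffices: clearing the factor `1 / ⟨v, v⟩` turns the bound into
  -- `⟨v, S v⟩ ≤ ⟨v, v⟩`.
  have h1 := h (DensityOp.ofVec v hv)
  obtain ⟨hn, hn'⟩ := Complex.lt_def.1 (Matrix.dotProduct_star_self_pos_iff.2 hv)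
  obtain ⟨-, hS'⟩ := Complex.le_def.1 (hS.dotProduct_mulVec_nonneg v)
  generalize hN₀ : star v ⬝ᵥ v = N at hn hn'
  have hN : N = (N.re : ℂ) := Complex.ext rfl hn'.symm
  rw [DensityOp.ofVec, Matrix.smul_mul, Matrix.trace_smul, ketbra_mul_trace, smul_eq_mul] at h1
  rw [hN₀, hN, ← Complex.ofReal_inv, Complex.re_ofReal_mul, inv_mul_le_one₀ hn] at h1
  rw [Matrix.sub_mulVec, Matrix.one_mulVec, dotProduct_sub, hN₀]
  -- The order on `ℂ` also demands equal imaginary parts; both quadratic forms are real.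
  refine Complex.le_def.2 ⟨sub_nonneg.2 h1, ?_⟩
  rw [Complex.sub_im, ← hS', ← hn']
  simp

/-! ### Measurements and tensor products of effects -/

namespace POVM

variable {Q O R : Type} [Fintype Q] [DecidableEq Q] [Fintype O] [Fintype R]

/-- The measurement that performs `E` and applies `f` to the outcome. -/
def map [DecidableEq R] (E : POVM Q O) (f : O → R) : POVM Q R where
  elem r := ∑ o, if f o = r then E.elem o else 0
  psd r := Matrix.posSemidef_sum _ fun o _ => by
    split_ifs
    exacts [E.psd o, Matrix.PosSemidef.zero]
  sum_elem := by
    rw [Finset.sum_comm]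
    simp [E.sum_elem]

/-- The two-outcome measurement with elements `S` and `1 - S`. -/
def binary (S : Matrix Q Q ℂ) (hS : S.PosSemidef) (hS' : (1 - S).PosSemidef) : POVM Q Bool where
  elem b := if b then S else 1 - S
  psd b := by cases b <;> simpa
  sum_elem := by simp

/-- The complement is the sum of the remaining elements of the measurement. -/
theorem one_sub_elem_posSemidef [DecidableEq O] (E : POVM Q O) (o : O) :
    (1 - E.elem o).PosSemidef := by
  rw [← E.sum_elem, ← Finset.add_sum_erase _ _ (Finset.mem_univ o), add_sub_cancel_left]
  exact Matrix.posSemidef_sum _ fun o _ => E.psd o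

end POVM

/-- Measure each register with the two-outcome measurement `{S i, 1 - S i}`: the tensor product is
the element for the all-`true` outcome of the product measurement, hence at most 1. -/
theorem one_sub_tensorAll_posSemidef {k : ℕ} {Q : Type} [Fintype Q] [DecidableEq Q]
    {S : Fin k → Matrix Q Q ℂ} (hS : ∀ i, (S i).PosSemidef) (hS' : ∀ i, (1 - S i).PosSemidef) :
    (1 - tensorAll S).PosSemidef :=
  (POVM.pi fun i => POVM.binary (S i) (hS i) (hS' i)).one_sub_elem_posSemidef fun _ => true

theorem tensorAll_ite {k : ℕ} {Q R : Type} (p : Fin k → Prop) [DecidablePred p]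
    [Decidable (∀ i, p i)] (M : Fin k → Matrix Q R ℂ) :
    tensorAll (fun i => if p i then M i else 0) = if ∀ i, p i then tensorAll M else 0 := by
  split_ifs with h
  · simp [h]
  · obtain ⟨i, hi⟩ := not_forall.1 h
    ext u v
    exact Finset.prod_eq_zero (Finset.mem_univ i) (by simp [hi])

/-! ### Acceptance of a single copy -/

namespace XiProtocol

variable (P : XiProtocol) {n : ℕ} (x : List Bool) (H : UniversalHash n (P.respLen x))

/-- The operator of the event that the verifier accepts one copy of the compiled protocol with
classical message `t`, on challenge `c`. -/
noncomputable def copyAccept (t : OTMsg H) (c : Bool) :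
    Matrix (Bits (P.msgQubits x) × Bits n) (Bits (P.msgQubits x) × Bits n) ℂ :=
  ∑ o : Bits (P.outLen x) × Bits n,
    if P.pred x o.1 c (otOutput H t c o.2) = true then
      ((P.meas x c).prod (bb84Meas fun _ => c)).elem o else 0

theorem copyAccept_psd (t : OTMsg H) (c : Bool) : (P.copyAccept x H t c).PosSemidef :=
  Matrix.posSemidef_sum _ fun o _ => by
    split_ifs
    exacts [POVM.psd _ o, Matrix.PosSemidef.zero]

/-- The interactive prover that keeps the register `X` of one copy as its private register, and on
challenge `c` does to it what the verifier of the compiled protocol would do. -/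
noncomputable def copyProver (t : OTMsg H) (σ : DensityOp (Bits (P.msgQubits x) × Bits n)) :
    InteractiveProver (Bits (P.msgQubits x)) (Bits (P.respLen x)) where
  B := Bits n
  state := σ
  respond c := (bb84Meas fun _ => c).map (otOutput H t c)

/-- The attack on Π and the compiled verifier make the same measurements on `A` and `X`; only the
place where `X` is measured differs. The proof regroups the outcomes `s` of `X` by the response they
produce. -/
theorem acceptProb_copyProver (t : OTMsg H) (σ : DensityOp (Bits (P.msgQubits x) × Bits n)) :
    P.acceptProb x (P.copyProver x H t σ) =
      (1 / 2) * (σ.op * ∑ c, P.copyAccept x H t c).trace.re := by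
  rw [acceptProb, Matrix.mul_sum, Matrix.trace_sum, Complex.re_sum]
  congr 1
  refine Finset.sum_congr rfl fun c _ => ?_
  rw [copyAccept, Matrix.mul_sum, Matrix.trace_sum, Complex.re_sum, Fintype.sum_prod_type]
  refine Finset.sum_congr rfl fun a _ => ?_
  have h : ∀ r, (P.meas x c).elem a ⊗ₖ ((bb84Meas fun _ => c).map (otOutput H t c)).elem r =
      ∑ s, if otOutput H t c s = r then (P.meas x c).elem a ⊗ₖ (bb84Meas fun _ => c).elem s
        else 0 := by
    intro r
    ext u v
    simp only [POVM.map, Matrix.sum_apply, Matrix.kroneckerMap_apply, Finset.mul_sum]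
    refine Finset.sum_congr rfl fun s _ => ?_
    split_ifs <;> simp
  have h' : ∀ r, (if P.pred x a c r = true then (σ.op *
      ((P.meas x c).elem a ⊗ₖ ((bb84Meas fun _ => c).map (otOutput H t c)).elem r)).trace.re
        else 0) =
      ∑ s, if otOutput H t c s = r then (if P.pred x a c r = true then
        (σ.op * ((P.meas x c).elem a ⊗ₖ (bb84Meas fun _ => c).elem s)).trace.re else 0) else 0 := by
    intro r
    rw [h]
    split_ifs with hp
    · rw [Matrix.mul_sum, Matrix.trace_sum, Complex.re_sum]
      refine Finset.sum_congr rfl fun s _ => ?_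
      split_ifs <;> simp
    · simp
  refine (Finset.sum_congr rfl fun r _ => h' r).trans ?_
  -- Each outcome `s` determines exactly one response, so the sum over `r` collapses.
  rw [Finset.sum_comm]
  refine Finset.sum_congr rfl fun s _ => ?_
  rw [Finset.sum_ite_eq, if_pos (Finset.mem_univ _)]
  split_ifs
  · rfl
  · simp

theorem sum_copyAccept_le_one {L : Language Bool} (hP : P.IsSound L (1 / 2)) (hx : x ∉ L)
    (t : OTMsg H) : (1 - ∑ c, P.copyAccept x H t c).PosSemidef := by
  refine one_sub_posSemidef_of_trace_le
    (Matrix.posSemidef_sum _ fun c _ => P.copyAccept_psd x H t c) fun σ => ?_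
  have h := hP x hx (P.copyProver x H t σ)
  rw [acceptProb_copyProver] at h
  -- The ½ of the uniform challenge cancels the soundness error ½, leaving the bound 1.
  linarith

/-! ### Acceptance of all `k` copies -/

open scoped Classical in
theorem sum_decision_elem (H : ∀ x, UniversalHash n (P.respLen x)) (k : ℕ) (c : Bits k)
    (t : Fin k → OTMsg (H x)) :
    (∑ o, if (P.NIP H k x).decision c o t then ((P.NIP H k x).meas c).elem o else 0) =
      tensorAll fun i => P.copyAccept x (H x) (t i) (c i) := by
  unfold copyAccept
  rw [← tensorAll_sum fun i (o : Bits (P.outLen x) × Bits n) =>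
    if P.pred x o.1 (c i) (otOutput (H x) (t i) (c i) o.2) = true then
      ((P.meas x (c i)).prod (bb84Meas fun _ => c i)).elem o else 0]
  refine Finset.sum_congr rfl fun o _ => ?_
  -- A single rejecting copy makes one tensor factor zero, which matches the verifier's conjunction
  -- over the copies.
  rw [tensorAll_ite (fun i => P.pred x (o i).1 (c i) (otOutput (H x) (t i) (c i) (o i).2) = true)]
  exact if_congr Iff.rfl rfl rfl

theorem NIP_acceptProb (H : ∀ x, UniversalHash n (P.respLen x)) (k : ℕ)
    (ρ : CQState (Fin k → Bits (P.msgQubits x) × Bits n) (Fin k → OTMsg (H x))) :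
    (P.NIP H k x).acceptProb ρ = (2 ^ k)⁻¹ *
      ∑ t, (ρ.op t * tensorAll fun i => ∑ c, P.copyAccept x (H x) (t i) c).trace.re := by
  classical
  rw [OneMessageProof.acceptProb, Finset.sum_comm]
  congr 1
  · simp
  refine Finset.sum_congr rfl fun t _ => ?_
  -- Neither `t` nor `ρ.op t` depends on the challenges, so the sum over challenge strings acts on
  -- the operators alone and distributes over the tensor factors.
  rw [← tensorAll_sum fun i => P.copyAccept x (H x) (t i), Matrix.mul_sum, Matrix.trace_sum,
    Complex.re_sum]
  refine Finset.sum_congr rfl fun c _ => ?_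
  rw [← sum_decision_elem, Matrix.mul_sum, Matrix.trace_sum, Complex.re_sum]
  refine Finset.sum_congr rfl fun o _ => ?_
  split_ifs <;> simp

end XiProtocol

theorem mainTheorem1 (P : XiProtocol) (L : Language Bool) (hP : P.IsSound L (1 / 2))
    (n : ℕ) (H : ∀ x, UniversalHash n (P.respLen x)) (k : ℕ) :
    OneMessageProof.IsSound (P.NIP H k) L (1 / 2 ^ k) := by
  intro x hx ρ
  rw [XiProtocol.NIP_acceptProb, one_div]
  refine mul_le_of_le_one_right (by positivity) ?_
  calc
    _ ≤ ∑ t, (ρ.op t).trace.re := Finset.sum_le_sum fun t _ => by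
      -- Pairing the positive operator `1 - ⨂ S i` with `ρ.op t` bounds each term by the probability
      -- of `t`.
      have h := (ρ.psd t).trace_mul_re_nonneg (one_sub_tensorAll_posSemidef
        (fun i => Matrix.posSemidef_sum _ fun c _ => P.copyAccept_psd x (H x) (t i) c)
        fun i => P.sum_copyAccept_le_one x (H x) hP hx (t i))
      rw [Matrix.mul_sub, Matrix.mul_one, Matrix.trace_sub, Complex.sub_re] at h
      exact sub_nonneg.1 h
    _ = 1 := by rw [← Complex.re_sum, ρ.trace_op, Complex.one_re]
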